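/- Let $d\in\mathbb N_0$, let $\mathbb T^d=(\mathbb R/\mathbb Z)^d$, let $\mathcal I\subseteq\mathbb Z^d$ be a finite set of frequencies, let $t>0$, and let $n\in\mathbb N_0$ satisfy $n\ge 10\,|\mathcal I|(\log|\mathcal I|+t)$ (the right-hand side being $0$ if $\mathcal I=\emptyset$). Let $\boldsymbol X=(\boldsymbol x^1,\dots,\boldsymbol x^n)$ be independent points, uniformly distributed on $\mathbb T^d$, and let $\boldsymbol\varepsilon=(\varepsilon_1,\dots,\varepsilon_n)$ be independent of $\boldsymbol X$, with i.i.d. complex-valued square-integrable entries of mean zero and variance $\mathbb E|\varepsilon_i|^2=\sigma^2$. For $\boldsymbol y\in\mathbb C^n$ let $$S_{\mathcal I}^{\boldsymbol X}\boldsymbol y=\operatorname{arg\,min}\Big\{\sum_{i=1}^n|g(\boldsymbol x^i)-y_i|^2 : g\in\operatorname{span}\{\exp(2\pi\mathrm i\langle\boldsymbol k,\cdot\rangle)\}_{\boldsymbol k\in\mathcal I}\Big\}$$ be the least squares approximation. Then, with probability at least $1-2\exp(-t)$ in the random choice of the points $\boldsymbol X$, the minimizer $S_{\mathcal I}^{\boldsymbol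 X}\boldsymbol y$ is unique for every $\boldsymbol y\in\mathbb C^n$, and the Fourier coefficients $\hat g_{\boldsymbol k}$ of the fitted noise $S_{\mathcal I}^{\boldsymbol X}\boldsymbol\varepsilon=\sum_{\boldsymbol k\in\mathcal I}\hat g_{\boldsymbol k}\exp(2\pi\mathrm i\langle\boldsymbol k,\cdot\rangle)$ satisfy, simultaneously for all $\boldsymbol k\in\mathcal I$, $$\frac{2\sigma^2}{3n}\le\mathbb E_{\boldsymbol\varepsilon}\big(|\hat g_{\boldsymbol k}|^2\big)\le\frac{2\sigma^2}{n},$$ where $\mathbb E_{\boldsymbol\varepsilon}$ is the expectation over the noise with the points held fixed. -/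

import Mathlib

open MeasureTheory ProbabilityTheory

/-- The space of trigonometric polynomials on the torus `(ℝ/ℤ)^d` with frequencies in `I`, that is,
the complex span of the functions `x ↦ exp (2πi⟨k, x⟩)`, `k ∈ I`. -/
noncomputable def trigPoly {d : ℕ} (I : Finset (Fin d → ℤ)) :
    Submodule ℂ C(UnitAddTorus (Fin d), ℂ) :=
  Submodule.span ℂ (UnitAddTorus.mFourier '' (I : Set (Fin d → ℤ)))

/-- `g` is a least squares approximation with frequencies in `I` to the data `y` at the points `x`:
it minimizes `∑ i, |g (x i) - y i|²` over the trigonometric polynomials with frequencies in `I`. -/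
def IsLeastSquares {d n : ℕ} (I : Finset (Fin d → ℤ)) (x : Fin n → UnitAddTorus (Fin d))
    (y : Fin n → ℂ) (g : C(UnitAddTorus (Fin d), ℂ)) : Prop :=
  g ∈ trigPoly I ∧
    ∀ h ∈ trigPoly I, ∑ i, ‖g (x i) - y i‖ ^ 2 ≤ ∑ i, ‖h (x i) - y i‖ ^ 2

open Classical in
/-- The least squares approximation to the data `y` at the points `x`, as a function on the torus.
It is the minimizer whenever there is exactly one (and `0`, by convention, otherwise). -/
noncomputable def leastSquares {d n : ℕ} (I : Finset (Fin d → ℤ))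
    (x : Fin n → UnitAddTorus (Fin d)) (y : Fin n → ℂ) : C(UnitAddTorus (Fin d), ℂ) :=
  if h : ∃! g, IsLeastSquares I x y g then h.choose else 0

/-! Let `F` be the sampling matrix in the exponential basis and `G = Fᴴ * F`. Where `F` is
injective, the minimizer is unique and has coefficient vector `F⁺ y`, with `F⁺ = G⁻¹ * Fᴴ`.
Independence and centering of the noise then make the expected squared coefficient equal to `σ²`
times the squared norm of row `k` of `F⁺`, so both bounds concern that row.

Upper bound: the squared row norm is the diagonal entry `G⁻¹ k k`, at most `2/n` once `G ≥ n/2`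
(`sum_norm_sq_pinv_le`). Lower bound: `F⁺ * F = 1` and the entries of `F` are unimodular, so
Cauchy–Schwarz gives at least `1/n`, better than `2/(3n)` (`inv_le_sum_norm_sq_pinv`). No upper
bound on `G` is needed.

Hence the only random event is `G ≥ n/2`, and one tail suffices, with failure probability `exp (-t)`
instead of `2 * exp (-t)`. Since `G / |I|` is a sum of independent rank-one projections of mean `1 /
|I|`, this is the lower matrix Chernoff bound. It rests on Golden–Thompson, obtained from a trace
inequality for powers `2 ^ j` and the Lie–Trotter formula. -/

namespace Matrix

/-! ### Trace inequalities for powers of products of Hermitian matrices. -/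

section TraceInequality

open scoped ComplexOrder

variable {ι : Type*} [Fintype ι]

theorem re_trace_mul_conjTranspose_self_nonneg (X : Matrix ι ι ℂ) :
    0 ≤ (X * Xᴴ).trace.re :=
  (Complex.nonneg_iff.mp (posSemidef_self_mul_conjTranspose X).trace_nonneg).1

theorem re_trace_conjTranspose (X : Matrix ι ι ℂ) : Xᴴ.trace.re = X.trace.re := by
  simp [trace_conjTranspose]

/-- Expand the squared Hilbert–Schmidt norm of `X - Xᴴ`. -/
theorem re_trace_sq_le (X : Matrix ι ι ℂ) : (X * X).trace.re ≤ (X * Xᴴ).trace.re := by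
  have h := re_trace_mul_conjTranspose_self_nonneg (X - Xᴴ)
  have h1 : (Xᴴ * Xᴴ).trace.re = (X * X).trace.re := by
    rw [← conjTranspose_mul, re_trace_conjTranspose]
  simp only [conjTranspose_sub, conjTranspose_conjTranspose, sub_mul, mul_sub, trace_sub,
    Complex.sub_re, h1, trace_mul_comm Xᴴ X] at h
  linarith

theorem IsHermitian.re_trace_mul_le {P Q : Matrix ι ι ℂ} (hP : P.IsHermitian)
    (hQ : Q.IsHermitian) :
    (P * Q).trace.re ≤ ((P * P).trace.re + (Q * Q).trace.re) / 2 := by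
  have h := re_trace_mul_conjTranspose_self_nonneg (P - Q)
  rw [(hP.sub hQ).eq] at h
  simp only [sub_mul, mul_sub, trace_sub, Complex.sub_re, trace_mul_comm Q P] at h
  linarith

variable [DecidableEq ι]

theorem trace_mul_pow_comm (X Y : Matrix ι ι ℂ) (m : ℕ) :
    ((X * Y) ^ m).trace = ((Y * X) ^ m).trace := by
  rcases m with _ | m
  · simp
  · have h : (X * Y) ^ (m + 1) = X * (Y * X) ^ m * Y := by
      induction m with
      | zero => simp
      | succ m ih => rw [pow_succ, ih, pow_succ (Y * X)]; simp only [mul_assoc]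
    rw [h, trace_mul_comm, ← mul_assoc, ← pow_succ']

/-- The two claims feed each other: the first at `j + 1` uses both at `j`, applied to `X * X` and to
the pair `Xᴴ * X`, `X * Xᴴ`; the second uses the first on `A * B` and then itself on `A ^ 2`, `B ^
2`. Cyclicity of the trace regroups the factors. -/
theorem re_trace_pow_two_pow_aux (j : ℕ) :
    (∀ X : Matrix ι ι ℂ, (X ^ (2 * 2 ^ j)).trace.re ≤ ((X * Xᴴ) ^ 2 ^ j).trace.re) ∧
    (∀ A B : Matrix ι ι ℂ, A.IsHermitian → B.IsHermitian →
      ((A * B) ^ 2 ^ j).trace.re ≤ (A ^ 2 ^ j * B ^ 2 ^ j).trace.re) := by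
  induction j with
  | zero => exact ⟨fun X => by simpa [pow_two] using re_trace_sq_le X, fun A B _ _ => by simp⟩
  | succ j ih =>
    obtain ⟨hD, hC⟩ := ih
    refine ⟨fun X => ?_, fun A B hA hB => ?_⟩
    · have hP : (Xᴴ * X).IsHermitian := isHermitian_conjTranspose_mul_self X
      have hQ : (X * Xᴴ).IsHermitian := isHermitian_mul_conjTranspose_self X
      calc (X ^ (2 * 2 ^ (j + 1))).trace.re = ((X * X) ^ (2 * 2 ^ j)).trace.re := by
            rw [← pow_two, ← pow_mul]; ring_nf
        _ ≤ ((X * X * (X * X)ᴴ) ^ 2 ^ j).trace.re := hD _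
        _ = ((Xᴴ * X * (X * Xᴴ)) ^ 2 ^ j).trace.re := by
            rw [conjTranspose_mul, trace_mul_pow_comm (Xᴴ * X)]
            rw [show X * X * (Xᴴ * Xᴴ) = X * (X * Xᴴ * Xᴴ) by simp only [mul_assoc],
              trace_mul_pow_comm]
            simp only [mul_assoc]
        _ ≤ ((Xᴴ * X) ^ 2 ^ j * (X * Xᴴ) ^ 2 ^ j).trace.re := hC _ _ hP hQ
        _ ≤ _ := (hP.pow _).re_trace_mul_le (hQ.pow _)
        _ = ((X * Xᴴ) ^ 2 ^ (j + 1)).trace.re := by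
            rw [← pow_add, ← pow_add, trace_mul_pow_comm Xᴴ X, pow_succ 2 j, mul_two]
            ring
    · calc ((A * B) ^ 2 ^ (j + 1)).trace.re = ((A * B) ^ (2 * 2 ^ j)).trace.re := by
            rw [pow_succ 2 j, mul_comm]
        _ ≤ ((A * B * (A * B)ᴴ) ^ 2 ^ j).trace.re := hD _
        _ = ((A ^ 2 * B ^ 2) ^ 2 ^ j).trace.re := by
            rw [conjTranspose_mul, hA.eq, hB.eq,
              show A * B * (B * A) = A * B * B * A by simp only [mul_assoc], trace_mul_pow_comm]
            simp only [pow_two, mul_assoc]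
        _ ≤ _ := hC _ _ (hA.pow 2) (hB.pow 2)
        _ = _ := by rw [← pow_mul, ← pow_mul, pow_succ 2 j, mul_comm]

theorem IsHermitian.re_trace_mul_pow_two_pow_le {A B : Matrix ι ι ℂ} (hA : A.IsHermitian)
    (hB : B.IsHermitian) (j : ℕ) :
    ((A * B) ^ 2 ^ j).trace.re ≤ (A ^ 2 ^ j * B ^ 2 ^ j).trace.re :=
  (re_trace_pow_two_pow_aux j).2 A B hA hB

end TraceInequality
end Matrix

/-! ### The Lie–Trotter product formula. -/

section LieTrotter

open Filter Topology NormedSpace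

variable {𝔸 : Type*} [NormedRing 𝔸]

theorem norm_pow_sub_pow_le_of_norm_le [NormOneClass 𝔸] {a b : 𝔸} {K : ℝ} (hK : 1 ≤ K)
    (ha : ‖a‖ ≤ K) (hb : ‖b‖ ≤ K) (m : ℕ) : ‖a ^ m - b ^ m‖ ≤ m * K ^ m * ‖a - b‖ := by
  induction m with
  | zero => simp
  | succ m ih =>
    have h : a ^ (m + 1) - b ^ (m + 1) = a ^ m * (a - b) + (a ^ m - b ^ m) * b := by
      simp only [pow_succ]; noncomm_ring
    have h0 : 0 ≤ K := by linarith
    calc ‖a ^ (m + 1) - b ^ (m + 1)‖ ≤ ‖a ^ m‖ * ‖a - b‖ + ‖a ^ m - b ^ m‖ * ‖b‖ := by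
          rw [h]; exact (norm_add_le _ _).trans (add_le_add (norm_mul_le _ _) (norm_mul_le _ _))
      _ ≤ K ^ (m + 1) * ‖a - b‖ + (m * K ^ m * ‖a - b‖) * K := by
          gcongr
          exact (norm_pow_le _ _).trans ((pow_le_pow_left₀ (norm_nonneg _) ha m).trans
            (pow_le_pow_right₀ hK m.le_succ))
      _ = _ := by push_cast; ring

variable [NormedAlgebra ℝ 𝔸] [NormOneClass 𝔸] [CompleteSpace 𝔸]

theorem NormedSpace.norm_exp_le_exp_norm (x : 𝔸) : ‖exp x‖ ≤ Real.exp ‖x‖ := by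
  have hx := exp_series_hasSum_exp' (𝕂 := ℝ) x
  have hr := exp_series_hasSum_exp' (𝕂 := ℝ) ‖x‖
  rw [← hx.tsum_eq, Real.exp_eq_exp_ℝ]
  refine tsum_of_norm_bounded hr fun m => ?_
  rw [norm_smul, norm_inv, Real.norm_natCast, smul_eq_mul]
  gcongr
  exact norm_pow_le _ _

/-- The two one-step exponentials agree to first order, so they differ by `o(1/m)`; taking `m`-th
powers costs only a factor `m * exp (‖a‖ + ‖b‖)`. -/
theorem tendsto_exp_mul_exp_pow (a b : 𝔸) :
    Tendsto (fun m : ℕ => (exp ((m : ℝ)⁻¹ • a) * exp ((m : ℝ)⁻¹ • b)) ^ m) atTop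
      (𝓝 (exp (a + b))) := by
  have hder : HasDerivAt (fun s : ℝ => exp (s • a) * exp (s • b) - exp (s • (a + b))) 0 0 := by
    have h := ((hasDerivAt_exp_smul_const a (0 : ℝ)).mul (hasDerivAt_exp_smul_const b (0 : ℝ))).sub
      (hasDerivAt_exp_smul_const (a + b) (0 : ℝ))
    exact (h.congr_deriv (by simp)).congr_of_eventuallyEq (.of_forall fun _ => rfl)
  have hlim : Tendsto (fun m : ℕ => (m : ℝ) * ‖exp ((m : ℝ)⁻¹ • a) * exp ((m : ℝ)⁻¹ • b) -
      exp ((m : ℝ)⁻¹ • (a + b))‖) atTop (𝓝 0) := by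
    have h := (hasDerivAt_iff_tendsto_slope.mp hder).comp
      (tendsto_inv_atTop_nhdsGT_zero.comp (tendsto_natCast_atTop_atTop (R := ℝ)) |>.mono_right
        (nhdsWithin_mono _ fun y hy => ne_of_gt hy))
    refine (tendsto_zero_iff_norm_tendsto_zero.mp h).congr fun m => ?_
    simp [slope_def_module, norm_smul]
  set K := ‖a‖ + ‖b‖
  rw [tendsto_iff_norm_sub_tendsto_zero]
  refine squeeze_zero' (.of_forall fun _ => norm_nonneg _) ?_
    (by simpa only [mul_zero] using hlim.const_mul (Real.exp K))
  filter_upwards [eventually_gt_atTop 0] with m hm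
  have hm' : (m : ℝ) ≠ 0 := by positivity
  let _ : NormedAlgebra ℚ 𝔸 := NormedAlgebra.restrictScalars ℚ ℝ 𝔸
  have hexp : exp (a + b) = exp ((m : ℝ)⁻¹ • (a + b)) ^ m := by
    rw [← exp_nsmul, ← Nat.cast_smul_eq_nsmul ℝ, smul_smul, mul_inv_cancel₀ hm', one_smul]
  have hn : ∀ x : 𝔸, ‖(m : ℝ)⁻¹ • x‖ = (m : ℝ)⁻¹ * ‖x‖ := fun x => by
    rw [norm_smul, norm_inv, Real.norm_natCast]
  have h1 : ‖exp ((m : ℝ)⁻¹ • a) * exp ((m : ℝ)⁻¹ • b)‖ ≤ Real.exp ((m : ℝ)⁻¹ * K) := by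
    refine (norm_mul_le _ _).trans ?_
    rw [mul_add, Real.exp_add, ← hn, ← hn]
    gcongr <;> exact norm_exp_le_exp_norm _
  have h2 : ‖exp ((m : ℝ)⁻¹ • (a + b))‖ ≤ Real.exp ((m : ℝ)⁻¹ * K) := by
    refine (norm_exp_le_exp_norm _).trans (Real.exp_le_exp.mpr ?_)
    rw [hn]
    gcongr
    exact norm_add_le _ _
  rw [hexp]
  refine (norm_pow_sub_pow_le_of_norm_le (Real.one_le_exp (by positivity)) h1 h2 m).trans
    (le_of_eq ?_)
  rw [← Real.exp_nat_mul, mul_inv_cancel_left₀ hm',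
    mul_comm (m : ℝ), mul_assoc]

end LieTrotter

/-! ### Golden–Thompson. -/

namespace Matrix
open NormedSpace Filter Topology
open scoped Matrix.Norms.L2Operator

/-- The **Golden–Thompson inequality**. -/
theorem IsHermitian.re_trace_exp_add_le {ι : Type*} [Fintype ι] [DecidableEq ι]
    {A B : Matrix ι ι ℂ} (hA : A.IsHermitian) (hB : B.IsHermitian) :
    (NormedSpace.exp (A + B)).trace.re ≤
      (NormedSpace.exp A * NormedSpace.exp B).trace.re := by
  -- The identity matrix has norm one only for nonempty `ι`.
  rcases isEmpty_or_nonempty ι with h | h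
  · simp
  -- Lie–Trotter is taken along `m = 2 ^ j`, where the trace inequality is available.
  have hlim := (tendsto_exp_mul_exp_pow A B).comp
    (tendsto_pow_atTop_atTop_of_one_lt (one_lt_two (α := ℕ)))
  have hcont : Continuous fun M : Matrix ι ι ℂ => M.trace.re :=
    Complex.continuous_re.comp continuous_id.matrix_trace
  refine le_of_tendsto ((hcont.tendsto _).comp hlim) (.of_forall fun j => ?_)
  let _ : NormedAlgebra ℚ (Matrix ι ι ℂ) := NormedAlgebra.restrictScalars ℚ ℂ _
  have hm : ((2 ^ j : ℕ) : ℝ) ≠ 0 := by positivity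
  have hpow (M : Matrix ι ι ℂ) : NormedSpace.exp (((2 ^ j : ℕ) : ℝ)⁻¹ • M) ^ 2 ^ j =
      NormedSpace.exp M := by
    rw [← exp_nsmul, ← Nat.cast_smul_eq_nsmul ℝ, smul_smul, mul_inv_cancel₀ hm, one_smul]
  have hsmul {M : Matrix ι ι ℂ} (hM : M.IsHermitian) :
      (NormedSpace.exp (((2 ^ j : ℕ) : ℝ)⁻¹ • M)).IsHermitian :=
    IsHermitian.exp (by simp [IsHermitian, conjTranspose_smul, hM.eq])
  have := (hsmul hA).re_trace_mul_pow_two_pow_le (hsmul hB) j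
  rw [hpow, hpow] at this
  exact this

end Matrix

/-! ### Lower matrix Chernoff tail by the Laplace transform method. -/

section MatrixChernoff

open NormedSpace
open scoped Matrix.Norms.L2Operator ComplexOrder

variable {ι : Type*} [Fintype ι] [DecidableEq ι]

/-- All powers of `p` from the first on equal `p`; only the constant term of the series needs the
correction `1 - p`. -/
theorem IsIdempotentElem.exp_smul {𝔸 : Type*} [NormedRing 𝔸] [NormedAlgebra ℝ 𝔸] [CompleteSpace 𝔸]
    {p : 𝔸} (hp : IsIdempotentElem p) (s : ℝ) :
    exp (s • p) = 1 + (Real.exp s - 1) • p := by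
  have h1 : HasSum (fun m : ℕ => ((m.factorial : ℝ)⁻¹ * s ^ m) • p + if m = 0 then 1 - p else 0)
      (Real.exp s • p + (1 - p)) := by
    refine HasSum.add ?_ (hasSum_ite_eq 0 (1 - p))
    rw [Real.exp_eq_exp_ℝ]
    exact (exp_series_hasSum_exp' (𝕂 := ℝ) s).smul_const p
  have h2 := exp_series_hasSum_exp' (𝕂 := ℝ) (s • p)
  have h3 : exp (s • p) = Real.exp s • p + (1 - p) := by
    refine (?_ : HasSum _ _).unique h1
    convert h2 using 2 with m
    rcases m with _ | m
    · simp
    · rw [smul_pow, hp.pow_succ_eq, if_neg m.succ_ne_zero, add_zero, mul_smul]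
  rw [h3, sub_smul, one_smul]
  abel

theorem Matrix.IsHermitian.re_trace_exp_neg {T : Matrix ι ι ℂ} (hT : T.IsHermitian) :
    (NormedSpace.exp (-T)).trace.re = ∑ i, Real.exp (-hT.eigenvalues i) := by
  set U : Matrix ι ι ℂ := ↑hT.eigenvectorUnitary
  have hUinv : U⁻¹ = star U :=
    Matrix.inv_eq_right_inv (Unitary.coe_mul_star_self hT.eigenvectorUnitary)
  have hUunit : IsUnit U := (Unitary.toUnits hT.eigenvectorUnitary).isUnit
  have h : -T = U * diagonal (fun i => ((-hT.eigenvalues i : ℝ) : ℂ)) * U⁻¹ := by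
    conv_lhs => rw [hT.spectral_theorem, Unitary.conjStarAlgAut_apply]
    rw [hUinv, ← neg_mul, ← mul_neg, diagonal_neg]
    simp [U]
  rw [h, Matrix.exp_conj _ _ hUunit, Matrix.trace_mul_comm, ← Matrix.mul_assoc,
    hUinv, Unitary.coe_star_mul_self, one_mul]
  simp [Matrix.exp_diagonal, Matrix.trace, Pi.exp_def, ← Complex.exp_eq_exp_ℂ,
    Complex.exp_ofReal_re, -Complex.ofReal_neg]

theorem Matrix.IsHermitian.one_le_re_trace_exp_neg {T : Matrix ι ι ℂ} (hT : T.IsHermitian)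
    (hneg : ¬ T.PosSemidef) : 1 ≤ (NormedSpace.exp (-T)).trace.re := by
  rw [hT.posSemidef_iff_eigenvalues_nonneg, Pi.le_def] at hneg
  push Not at hneg
  obtain ⟨i, hi⟩ := hneg
  rw [hT.re_trace_exp_neg]
  calc (1 : ℝ) ≤ Real.exp (-hT.eigenvalues i) := Real.one_le_exp (by simpa using hi.le)
    _ ≤ _ := Finset.single_le_sum (f := fun i => Real.exp (-hT.eigenvalues i))
      (fun _ _ => (Real.exp_pos _).le) (Finset.mem_univ i)

theorem Matrix.IsHermitian.re_trace_exp_nonneg {H : Matrix ι ι ℂ} (hH : H.IsHermitian) :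
    0 ≤ (NormedSpace.exp H).trace.re := by
  have := hH.neg.re_trace_exp_neg
  rw [neg_neg] at this
  rw [this]
  positivity

theorem Matrix.continuous_re_trace_exp :
    Continuous fun M : Matrix ι ι ℂ => (exp M).trace.re := by
  let _ : NormedAlgebra ℚ (Matrix ι ι ℂ) := NormedAlgebra.restrictScalars ℚ ℂ _
  exact Complex.continuous_re.comp (exp_continuous.matrix_trace)

variable {α : Type*} [TopologicalSpace α] [CompactSpace α]
  [MeasurableSpace α] [BorelSpace α] {μ : Measure α} [IsProbabilityMeasure μ]
  {W : α → Matrix ι ι ℂ} {c : ℝ}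

theorem Continuous.integrable_of_compactSpace {β E : Type*} [TopologicalSpace β] [CompactSpace β]
    [MeasurableSpace β] [BorelSpace β] [NormedAddCommGroup E] {ν : Measure β} [IsFiniteMeasure ν]
    {f : β → E} (hf : Continuous f) : Integrable f ν :=
  hf.integrable_of_hasCompactSupport (.of_compactSpace f)

/-- Golden–Thompson splits off `exp (-W x)`, which is affine in the projection `W x`, so only its
mean enters. -/
theorem integral_re_trace_exp_sub_le (hW : Continuous W) (hherm : ∀ x, (W x).IsHermitian)
    (hidem : ∀ x, IsIdempotentElem (W x))
    (hmean : ∀ k l, ∫ x, W x k l ∂μ = if k = l then (c : ℂ) else 0)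
    {H : Matrix ι ι ℂ} (hH : H.IsHermitian) :
    ∫ x, (exp (H - W x)).trace.re ∂μ ≤ (1 - (1 - Real.exp (-1)) * c) * (exp H).trace.re := by
  have hint (k l : ι) : Integrable (fun x => W x k l) μ :=
    (hW.matrix_elem k l).integrable_of_compactSpace
  have htr (E : Matrix ι ι ℂ) : ∫ x, (E * W x).trace ∂μ = c * E.trace := by
    simp only [Matrix.trace, Matrix.diag, Matrix.mul_apply]
    rw [integral_finsetSum, Finset.mul_sum]
    · refine Finset.sum_congr rfl fun k _ => ?_
      rw [integral_finsetSum _ fun l _ => (hint l k).const_mul _]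
      simp only [integral_const_mul, hmean, mul_ite, mul_zero, Finset.sum_ite_eq', Finset.mem_univ,
        if_true]
      exact mul_comm _ _
    · exact fun k _ => integrable_finsetSum _ fun l _ => (hint l k).const_mul _
  have htri : Integrable (fun x => (exp H * W x).trace) μ :=
    (continuous_const.mul hW).matrix_trace.integrable_of_compactSpace
  have hbound (x : α) : (exp (H - W x)).trace.re ≤
      (exp H).trace.re - (1 - Real.exp (-1)) * (exp H * W x).trace.re := by
    have h := hH.re_trace_exp_add_le (hherm x).neg
    rw [← sub_eq_add_neg, ← neg_one_smul ℝ (W x), (hidem x).exp_smul, mul_add, mul_one,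
      Matrix.mul_smul, Matrix.trace_add, Matrix.trace_smul, Complex.add_re, Complex.smul_re,
      smul_eq_mul] at h
    linarith
  calc ∫ x, (exp (H - W x)).trace.re ∂μ
      ≤ ∫ x, ((exp H).trace.re - (1 - Real.exp (-1)) * (exp H * W x).trace.re) ∂μ :=
        integral_mono (Matrix.continuous_re_trace_exp.comp
          (continuous_const.sub hW)).integrable_of_compactSpace
          ((integrable_const _).sub (htri.re.const_mul _)) hbound
    _ = (1 - (1 - Real.exp (-1)) * c) * (exp H).trace.re := by
        have hre : ∫ x, (exp H * W x).trace.re ∂μ = c * (exp H).trace.re := by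
          rw [← Complex.re_ofReal_mul, ← htr]
          exact integral_re htri
        have hsub := integral_sub (integrable_const (μ := μ) (exp H).trace.re)
          (htri.re.const_mul (1 - Real.exp (-1)))
        simp only [RCLike.re_to_complex] at hsub
        rw [hsub, integral_const_mul, hre, integral_const, probReal_univ, one_smul]
        ring

variable [SecondCountableTopology α]

theorem integral_pi_re_trace_exp_sub_le (hW : Continuous W) (hherm : ∀ x, (W x).IsHermitian)
    (hidem : ∀ x, IsIdempotentElem (W x))
    (hmean : ∀ k l, ∫ x, W x k l ∂μ = if k = l then (c : ℂ) else 0)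
    (hc : (1 - Real.exp (-1)) * c ≤ 1) (n : ℕ) {H : Matrix ι ι ℂ} (hH : H.IsHermitian) :
    ∫ x, (exp (H - ∑ i, W (x i))).trace.re ∂(Measure.pi fun _ : Fin n => μ) ≤
      (1 - (1 - Real.exp (-1)) * c) ^ n * (exp H).trace.re := by
  -- With all points but one integrated out, the remaining `W` is absorbed into `H`.
  induction n generalizing H with
  | zero => simp
  | succ n ih =>
    have hq : 0 ≤ 1 - (1 - Real.exp (-1)) * c := by linarith
    have hmp := (measurePreserving_piFinSuccAbove (fun _ : Fin (n + 1) => μ) 0).symm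
    rw [← hmp.integral_comp']
    have hcont : Continuous fun z : α × (Fin n → α) =>
        (exp (H - W z.1 - ∑ i, W (z.2 i))).trace.re :=
      Matrix.continuous_re_trace_exp.comp (by fun_prop)
    have heq (z : α × (Fin n → α)) : (exp (H - ∑ i, W
        ((MeasurableEquiv.piFinSuccAbove (fun _ => α) 0).symm z i))).trace.re =
        (exp (H - W z.1 - ∑ i, W (z.2 i))).trace.re := by
      simp [Fin.sum_univ_succ, MeasurableEquiv.piFinSuccAbove_symm_apply, Fin.insertNthEquiv,
        sub_sub]
    simp_rw [heq]
    have hi := hcont.integrable_of_compactSpace (ν := μ.prod (Measure.pi fun _ : Fin n => μ))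
    rw [integral_prod _ hi]
    calc _ ≤ ∫ x, (1 - (1 - Real.exp (-1)) * c) ^ n * (exp (H - W x)).trace.re ∂μ :=
          integral_mono hi.integral_prod_left
            ((Matrix.continuous_re_trace_exp.comp
              (continuous_const.sub hW)).integrable_of_compactSpace.const_mul _)
            fun x => ih (hH.sub (hherm x))
      _ ≤ (1 - (1 - Real.exp (-1)) * c) ^ n *
          ((1 - (1 - Real.exp (-1)) * c) * (exp H).trace.re) := by
          rw [integral_const_mul]
          exact mul_le_mul_of_nonneg_left
            (integral_re_trace_exp_sub_le hW hherm hidem hmean hH) (pow_nonneg hq n)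
      _ = _ := by ring

/-- The lower tail of the **matrix Chernoff inequality** for independent random projections. -/
theorem measureReal_pi_not_posSemidef_sum_sub_le (hW : Continuous W)
    (hherm : ∀ x, (W x).IsHermitian) (hidem : ∀ x, IsIdempotentElem (W x))
    (hmean : ∀ k l, ∫ x, W x k l ∂μ = if k = l then (c : ℂ) else 0)
    (hc : (1 - Real.exp (-1)) * c ≤ 1) (n : ℕ) (a : ℝ) :
    (Measure.pi fun _ : Fin n => μ).real
        {x | ¬ (∑ i, W (x i) - a • (1 : Matrix ι ι ℂ)).PosSemidef} ≤
      Fintype.card ι * Real.exp (a - (1 - Real.exp (-1)) * c * n) := by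
  have hH : (a • (1 : Matrix ι ι ℂ)).IsHermitian := by
    simp [Matrix.IsHermitian, Matrix.conjTranspose_smul]
  have hS (x : Fin n → α) : (∑ i, W (x i)).IsHermitian := by
    simp [Matrix.IsHermitian, Matrix.conjTranspose_sum, (hherm _).eq]
  have htr : (exp (a • (1 : Matrix ι ι ℂ))).trace.re = Fintype.card ι * Real.exp a := by
    rw [IsIdempotentElem.exp_smul .one]
    simp only [Matrix.trace_add, Matrix.trace_smul, Matrix.trace_one, Complex.add_re,
      Complex.smul_re, Complex.natCast_re, smul_eq_mul]
    ring
  set q := 1 - (1 - Real.exp (-1)) * c with hq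
  have hcont : Continuous fun x : Fin n → α => (exp (a • 1 - ∑ i, W (x i))).trace.re :=
    Matrix.continuous_re_trace_exp.comp (by fun_prop)
  calc (Measure.pi fun _ : Fin n => μ).real
        {x | ¬ (∑ i, W (x i) - a • (1 : Matrix ι ι ℂ)).PosSemidef}
      ≤ (Measure.pi fun _ : Fin n => μ).real
        {x | 1 ≤ (exp (a • 1 - ∑ i, W (x i))).trace.re} := by
        -- A negative eigenvalue of the difference contributes a term at least `1` to the trace
        -- exponential; Markov's inequality follows.
        refine measureReal_mono fun x hx => ?_
        have := ((hS x).sub hH).one_le_re_trace_exp_neg hx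
        rwa [neg_sub] at this
    _ ≤ ∫ x, (exp (a • 1 - ∑ i, W (x i))).trace.re ∂(Measure.pi fun _ : Fin n => μ) := by
        simpa using mul_meas_ge_le_integral_of_nonneg
          (.of_forall fun x => (hH.sub (hS x)).re_trace_exp_nonneg)
          hcont.integrable_of_compactSpace 1
    _ ≤ q ^ n * (Fintype.card ι * Real.exp a) := by
        rw [← htr]
        exact integral_pi_re_trace_exp_sub_le hW hherm hidem hmean hc n hH
    _ ≤ Real.exp (-((1 - Real.exp (-1)) * c)) ^ n * (Fintype.card ι * Real.exp a) := by
        gcongr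
        linarith [Real.add_one_le_exp (-((1 - Real.exp (-1)) * c))]
    _ = _ := by
        rw [← Real.exp_nat_mul, mul_left_comm, ← Real.exp_add]
        ring_nf

end MatrixChernoff

/-! ### Orthonormality of the exponentials on the torus. -/

section Torus

variable {d : Type*} [Fintype d]

theorem UnitAddCircle.volume_eq_haarAddCircle :
    (volume : Measure UnitAddCircle) = AddCircle.haarAddCircle := by
  rw [AddCircle.volume_eq_smul_haarAddCircle]; simp

theorem UnitAddTorus.volume_eq_pi_haarAddCircle :
    (volume : Measure (UnitAddTorus d)) = Measure.pi fun _ => AddCircle.haarAddCircle := by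
  rw [volume_pi]
  simp_rw [← UnitAddCircle.volume_eq_haarAddCircle]

instance UnitAddTorus.isProbabilityMeasure_volume :
    IsProbabilityMeasure (volume : Measure (UnitAddTorus d)) := by
  rw [volume_eq_pi_haarAddCircle]; infer_instance

theorem UnitAddTorus.mFourierCoeff_eq_integral_volume (f : UnitAddTorus d → ℂ) (k : d → ℤ) :
    mFourierCoeff f k = ∫ x, mFourier (-k) x * f x := by
  rw [UnitAddTorus.volume_eq_pi_haarAddCircle]
  rfl

theorem UnitAddTorus.integral_mFourier (k : d → ℤ) :
    ∫ x, mFourier k x = if k = 0 then 1 else 0 := by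
  split_ifs with hk
  · simp [hk, mFourier_zero]
  · obtain ⟨i, hi⟩ := Function.ne_iff.mp hk
    simp only [mFourier, ContinuousMap.coe_mk]
    rw [volume_eq_pi_haarAddCircle,
      integral_fintype_prod_eq_prod (fun i (z : UnitAddCircle) => fourier (k i) z)]
    refine Finset.prod_eq_zero (Finset.mem_univ i) ?_
    have h := (orthonormal_iff_ite.mp (orthonormal_fourier (T := 1))) 0 (k i)
    rw [if_neg (show (0 : ℤ) ≠ k i from Ne.symm hi)] at h
    simpa [ContinuousMap.inner_toLp] using h

theorem UnitAddTorus.integral_star_mFourier_mul_mFourier (k l : d → ℤ) :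
    ∫ x, star (mFourier k x) * mFourier l x = if k = l then 1 else 0 := by
  have h (x : UnitAddTorus d) : star (mFourier k x) * mFourier l x = mFourier (-k + l) x := by
    rw [mFourier_add, mFourier_neg]; rfl
  simp_rw [h, integral_mFourier, neg_add_eq_zero]

theorem UnitAddTorus.mFourierCoeff_mFourier (k l : d → ℤ) :
    mFourierCoeff (mFourier l) k = if k = l then 1 else 0 := by
  rw [mFourierCoeff_eq_integral_volume, ← integral_star_mFourier_mul_mFourier]
  simp_rw [mFourier_neg]; rfl

theorem UnitAddTorus.mFourier_mul_star_self (k : d → ℤ) (x : UnitAddTorus d) :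
    mFourier k x * star (mFourier k x) = 1 := by
  have : star (mFourier k x) = mFourier (-k) x := by rw [mFourier_neg]; rfl
  rw [this, ← mFourier_add]
  simp [mFourier_zero]

theorem UnitAddTorus.norm_mFourier_apply (k : d → ℤ) (x : UnitAddTorus d) :
    ‖mFourier k x‖ = 1 := by
  have h := congrArg norm (mFourier_mul_star_self k x)
  rw [norm_mul, norm_star, norm_one] at h
  nlinarith [norm_nonneg (mFourier k x)]

end Torus

/-! ### The sampling matrix and its stability with high probability. -/

section Sampling

open UnitAddTorus
open scoped Matrix ComplexOrder

theorem Matrix.sum_norm_sq_eq_re_star_dotProduct {m : Type*} [Fintype m] (v : m → ℂ) :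
    ∑ i, ‖v i‖ ^ 2 = (star v ⬝ᵥ v).re := by
  simp [dotProduct, ← Complex.normSq_eq_norm_sq, Complex.normSq_apply]

variable {d n : ℕ} (I : Finset (Fin d → ℤ))

/-- The matrix of the sampling map `g ↦ (g (x i))ᵢ` on trigonometric polynomials, in the basis of
exponentials. -/
noncomputable def fourierMatrix (x : Fin n → UnitAddTorus (Fin d)) : Matrix (Fin n) I ℂ :=
  Matrix.of fun i k => mFourier (k : Fin d → ℤ) (x i)

/-- The trigonometric polynomial with given coefficients. -/
noncomputable def trigPolyOfCoeff (c : I → ℂ) : C(UnitAddTorus (Fin d), ℂ) :=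
  ∑ k : I, c k • mFourier (k : Fin d → ℤ)

/-- The projection onto the line spanned by the conjugate of the vector of exponentials at `x`. -/
noncomputable def fourierProj (x : UnitAddTorus (Fin d)) : Matrix I I ℂ :=
  (I.card : ℝ)⁻¹ • Matrix.vecMulVec (fun k : I => star (mFourier (k : Fin d → ℤ) x))
    (fun k : I => mFourier (k : Fin d → ℤ) x)

variable {I}

theorem continuous_fourierProj : Continuous (fourierProj (d := d) I) := by
  unfold fourierProj
  refine (Continuous.matrix_vecMulVec ?_ ?_).const_smul (I.card : ℝ)⁻¹ <;> fun_prop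

theorem isHermitian_fourierProj (x : UnitAddTorus (Fin d)) : (fourierProj I x).IsHermitian := by
  ext k l
  simp [fourierProj, Matrix.vecMulVec_apply, mul_comm]

/-- The vector of exponentials has squared norm `|I|` at every point, since its entries are
unimodular. -/
theorem isIdempotentElem_fourierProj (x : UnitAddTorus (Fin d)) :
    IsIdempotentElem (fourierProj I x) := by
  rcases I.eq_empty_or_nonempty with rfl | hI
  · exact Subsingleton.elim _ _
  have hc : (I.card : ℝ) ≠ 0 := by exact_mod_cast hI.card_pos.ne'
  have h : (fun k : I => mFourier (k : Fin d → ℤ) x) ⬝ᵥ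
      (fun k : I => star (mFourier (k : Fin d → ℤ) x)) = (I.card : ℂ) := by
    simp only [dotProduct, mFourier_mul_star_self]
    simp
  rw [IsIdempotentElem, fourierProj, smul_mul_smul_comm, Matrix.vecMulVec_mul_vecMulVec, h]
  ext k l
  simp [Matrix.vecMulVec_apply]
  field_simp

theorem integral_fourierProj (k l : I) :
    ∫ x, fourierProj I x k l = if k = l then (((I.card : ℝ)⁻¹ : ℝ) : ℂ) else 0 := by
  simp only [fourierProj, Matrix.smul_apply, Matrix.vecMulVec_apply]
  rw [integral_smul, integral_star_mFourier_mul_mFourier]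
  by_cases h : k = l
  · simp [h]
  · rw [if_neg h, if_neg fun h' => h (Subtype.ext h'), smul_zero]

theorem sum_fourierProj (x : Fin n → UnitAddTorus (Fin d)) :
    ∑ i, fourierProj I (x i) = (I.card : ℝ)⁻¹ • ((fourierMatrix I x)ᴴ * fourierMatrix I x) := by
  ext k l
  rw [Matrix.sum_apply, Matrix.smul_apply, Matrix.mul_apply, Finset.smul_sum]
  rfl

theorem trigPolyOfCoeff_apply (c : I → ℂ) (x : Fin n → UnitAddTorus (Fin d)) (i : Fin n) :
    trigPolyOfCoeff I c (x i) = (fourierMatrix I x *ᵥ c) i := by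
  simp [trigPolyOfCoeff, fourierMatrix, Matrix.mulVec, dotProduct, mul_comm]

theorem mem_trigPoly_iff {g : C(UnitAddTorus (Fin d), ℂ)} :
    g ∈ trigPoly I ↔ ∃ c : I → ℂ, trigPolyOfCoeff I c = g := by
  rw [trigPoly, Set.image_eq_range, Submodule.mem_span_range_iff_exists_fun]
  rfl

theorem mFourierCoeff_trigPolyOfCoeff (c : I → ℂ) (k : I) :
    mFourierCoeff (trigPolyOfCoeff I c) k = c k := by
  rw [mFourierCoeff_eq_integral_volume]
  simp only [trigPolyOfCoeff, ContinuousMap.coe_sum, ContinuousMap.coe_smul, Finset.sum_apply,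
    Pi.smul_apply, smul_eq_mul, Finset.mul_sum]
  rw [integral_finsetSum _ fun l _ => Continuous.integrable_of_compactSpace (by fun_prop)]
  have h (l : I) : ∫ x, mFourier (-(k : Fin d → ℤ)) x * (c l * mFourier (l : Fin d → ℤ) x) =
      if k = l then c l else 0 := by
    have := mFourierCoeff_mFourier (k : Fin d → ℤ) (l : Fin d → ℤ)
    rw [mFourierCoeff_eq_integral_volume] at this
    simp_rw [mul_left_comm _ (c l), integral_const_mul, this, mul_ite, mul_one, mul_zero,
      Subtype.ext_iff]
  simp [h]

/-- The event that the sampling map is bounded below by half its mean square size. -/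
def SamplingStable (I : Finset (Fin d → ℤ)) (x : Fin n → UnitAddTorus (Fin d)) : Prop :=
  ∀ c : I → ℂ, (n / 2 : ℝ) * ∑ k, ‖c k‖ ^ 2 ≤ ∑ i, ‖(fourierMatrix I x *ᵥ c) i‖ ^ 2

theorem samplingStable_of_posSemidef (hI : I.Nonempty) {x : Fin n → UnitAddTorus (Fin d)}
    (h : (∑ i, fourierProj I (x i) -
      (n / (2 * I.card) : ℝ) • (1 : Matrix I I ℂ)).PosSemidef) : SamplingStable I x := by
  intro c
  have hc : (0 : ℝ) < I.card := by exact_mod_cast hI.card_pos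
  have h1 := (Complex.nonneg_iff.mp (h.dotProduct_mulVec_nonneg c)).1
  rw [sum_fourierProj, Matrix.sub_mulVec, dotProduct_sub, Matrix.smul_mulVec, Matrix.smul_mulVec,
    Matrix.one_mulVec, dotProduct_smul, dotProduct_smul, ← Matrix.mulVec_mulVec,
    Matrix.dotProduct_mulVec, Matrix.vecMul_conjTranspose, star_star, Complex.sub_re,
    Complex.smul_re, Complex.smul_re,
    ← Matrix.sum_norm_sq_eq_re_star_dotProduct, ← Matrix.sum_norm_sq_eq_re_star_dotProduct, smul_eq_mul,
    smul_eq_mul] at h1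
  have h3 := mul_le_mul_of_nonneg_left (sub_nonneg.mp h1) hc.le
  rw [mul_inv_cancel_left₀ hc.ne'] at h3
  refine le_trans (le_of_eq ?_) h3
  field_simp

theorem measureReal_not_samplingStable_le (I : Finset (Fin d → ℤ)) {t : ℝ}
    (hn : 10 * (I.card : ℝ) * (Real.log (I.card : ℝ) + t) ≤ (n : ℝ)) :
    (Measure.pi fun _ : Fin n => (volume : Measure (UnitAddTorus (Fin d)))).real
      {x | ¬ SamplingStable I x} ≤ Real.exp (-t) := by
  rcases I.eq_empty_or_nonempty with rfl | hI
  · have : {x : Fin n → UnitAddTorus (Fin d) | ¬ SamplingStable ∅ x} = ∅ := by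
      ext x
      simp only [Set.mem_ofPred_eq, Set.mem_empty_iff_false, iff_false, not_not]
      intro c
      simp
      positivity
    rw [this, measureReal_empty]
    positivity
  have hN : (1 : ℝ) ≤ I.card := by exact_mod_cast hI.card_pos
  have he := Real.exp_neg_one_lt_d9
  have hc : (1 - Real.exp (-1)) * (I.card : ℝ)⁻¹ ≤ 1 :=
    mul_le_one₀ (by linarith [Real.exp_pos (-1)]) (by positivity) (inv_le_one_of_one_le₀ hN)
  refine (measureReal_mono fun x hx => ?_).trans
    ((measureReal_pi_not_posSemidef_sum_sub_le (μ := volume) continuous_fourierProj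
      isHermitian_fourierProj isIdempotentElem_fourierProj integral_fourierProj hc n
      (n / (2 * I.card))).trans ?_)
  · exact fun h => hx (samplingStable_of_posSemidef hI h)
  · rw [Fintype.card_coe, ← Real.exp_log (zero_lt_one.trans_le hN), ← Real.exp_add,
      Real.exp_le_exp, Real.exp_log (zero_lt_one.trans_le hN)]
    have h1 : 10 * (Real.log I.card + t) ≤ n / I.card := by
      rw [le_div_iff₀ (by positivity)]
      linarith
    have h2 : (0 : ℝ) ≤ n / I.card := by positivity
    have h3 : (n / (2 * I.card) - (1 - Real.exp (-1)) * (I.card : ℝ)⁻¹ * n : ℝ) =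
        (1 / 2 - (1 - Real.exp (-1))) * (n / I.card) := by field_simp
    rw [h3]
    -- The coefficient `exp (-1) - 1/2` is below `-1/10`, so the factor `10` in `hn` absorbs both
    -- `log |I|` and `t`.
    nlinarith

end Sampling

/-! ### The least squares solution and the rows of the pseudoinverse. -/

section LeastSquares

open UnitAddTorus
open scoped Matrix ComplexOrder

variable {d n : ℕ} {I : Finset (Fin d → ℤ)} {x : Fin n → UnitAddTorus (Fin d)}

variable (I x) in
/-- The Moore–Penrose inverse of the matrix of the sampling map. -/
noncomputable def fourierPinv : Matrix I (Fin n) ℂ :=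
  ((fourierMatrix I x)ᴴ * fourierMatrix I x)⁻¹ * (fourierMatrix I x)ᴴ

namespace SamplingStable

theorem eq_zero_of_mulVec_eq_zero (h : SamplingStable I x) (hn : 0 < n) {c : I → ℂ}
    (hc : fourierMatrix I x *ᵥ c = 0) : c = 0 := by
  have h1 := h c
  have hn' : (0 : ℝ) < n / 2 := by positivity
  simp only [hc, Pi.zero_apply, norm_zero, ne_eq, OfNat.ofNat_ne_zero, not_false_eq_true, zero_pow,
    Finset.sum_const_zero] at h1
  have h2 : ∑ k, ‖c k‖ ^ 2 = 0 :=
    le_antisymm (nonpos_of_mul_nonpos_right h1 hn') (by positivity)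
  ext k
  have h3 := (Finset.sum_eq_zero_iff_of_nonneg fun k _ => by positivity).mp h2 k (Finset.mem_univ k)
  simpa using h3

theorem isUnit_gram (h : SamplingStable I x) (hn : 0 < n) :
    IsUnit ((fourierMatrix I x)ᴴ * fourierMatrix I x) := by
  rw [← Matrix.mulVec_injective_iff_isUnit]
  refine (injective_iff_map_eq_zero ((fourierMatrix I x)ᴴ * fourierMatrix I x).mulVecLin).mpr
    fun c hc => ?_
  exact h.eq_zero_of_mulVec_eq_zero hn ((Matrix.conjTranspose_mul_self_mulVec_eq_zero _ c).mp hc)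

theorem pinv_mul (h : SamplingStable I x) (hn : 0 < n) :
    fourierPinv I x * fourierMatrix I x = 1 := by
  rw [fourierPinv, Matrix.mul_assoc,
    Matrix.nonsing_inv_mul _ ((Matrix.isUnit_iff_isUnit_det _).mp (h.isUnit_gram hn))]

theorem normal_equation (h : SamplingStable I x) (hn : 0 < n) (y : Fin n → ℂ) :
    (fourierMatrix I x)ᴴ *ᵥ (fourierMatrix I x *ᵥ (fourierPinv I x *ᵥ y) - y) = 0 := by
  rw [Matrix.mulVec_sub, Matrix.mulVec_mulVec, Matrix.mulVec_mulVec, fourierPinv,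
    Matrix.mul_nonsing_inv_cancel_left _ _
      ((Matrix.isUnit_iff_isUnit_det _).mp (h.isUnit_gram hn)), sub_self]

/-- Pythagoras: by the normal equation the residual is orthogonal to the range of the sampling
matrix. -/
theorem sum_norm_sq_sub (h : SamplingStable I x) (hn : 0 < n) (y : Fin n → ℂ) (c : I → ℂ) :
    ∑ i, ‖(fourierMatrix I x *ᵥ c) i - y i‖ ^ 2 =
      ∑ i, ‖(fourierMatrix I x *ᵥ (fourierPinv I x *ᵥ y)) i - y i‖ ^ 2 +
      ∑ i, ‖(fourierMatrix I x *ᵥ (c - fourierPinv I x *ᵥ y)) i‖ ^ 2 := by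
  set F := fourierMatrix I x
  set b := fourierPinv I x *ᵥ y
  set r := F *ᵥ b - y with hr
  set w := F *ᵥ (c - b) with hw
  have h1 : F *ᵥ c - y = r + w := by rw [hr, hw, Matrix.mulVec_sub]; abel
  have h2 : star w ⬝ᵥ r = 0 := by
    rw [hw, Matrix.star_mulVec, ← Matrix.dotProduct_mulVec, h.normal_equation hn, dotProduct_zero]
  have h3 : star r ⬝ᵥ w = 0 := by
    rw [Matrix.star_dotProduct, h2, star_zero]
  calc ∑ i, ‖(F *ᵥ c) i - y i‖ ^ 2 = (star (F *ᵥ c - y) ⬝ᵥ (F *ᵥ c - y)).re :=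
        Matrix.sum_norm_sq_eq_re_star_dotProduct (F *ᵥ c - y)
    _ = (star r ⬝ᵥ r).re + (star w ⬝ᵥ w).re := by
        rw [h1, star_add, add_dotProduct, dotProduct_add, dotProduct_add, h2, h3]; simp
    _ = _ := by
        rw [← Matrix.sum_norm_sq_eq_re_star_dotProduct, ← Matrix.sum_norm_sq_eq_re_star_dotProduct]
        rfl

theorem isLeastSquares_iff (h : SamplingStable I x) (hn : 0 < n) (y : Fin n → ℂ)
    (g : C(UnitAddTorus (Fin d), ℂ)) :
    IsLeastSquares I x y g ↔ g = trigPolyOfCoeff I (fourierPinv I x *ᵥ y) := by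
  constructor
  · rintro ⟨hg, hmin⟩
    obtain ⟨c, rfl⟩ := mem_trigPoly_iff.mp hg
    have h1 := hmin _ (mem_trigPoly_iff.mpr ⟨fourierPinv I x *ᵥ y, rfl⟩)
    simp only [trigPolyOfCoeff_apply] at h1
    rw [h.sum_norm_sq_sub hn y c] at h1
    have h2 := h (c - fourierPinv I x *ᵥ y)
    have h3 : ∑ i, ‖(fourierMatrix I x *ᵥ (c - fourierPinv I x *ᵥ y)) i‖ ^ 2 = 0 :=
      le_antisymm (by linarith) (by positivity)
    have h4 : fourierMatrix I x *ᵥ (c - fourierPinv I x *ᵥ y) = 0 := by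
      ext i
      simpa using (Finset.sum_eq_zero_iff_of_nonneg fun i _ => by positivity).mp h3 i
        (Finset.mem_univ i)
    rw [sub_eq_zero.mp (h.eq_zero_of_mulVec_eq_zero hn h4)]
  · rintro rfl
    refine ⟨mem_trigPoly_iff.mpr ⟨_, rfl⟩, fun g hg => ?_⟩
    obtain ⟨c, rfl⟩ := mem_trigPoly_iff.mp hg
    simp only [trigPolyOfCoeff_apply]
    rw [h.sum_norm_sq_sub hn y c]
    exact le_add_of_nonneg_right (by positivity)

theorem existsUnique_isLeastSquares (h : SamplingStable I x) (hn : 0 < n) (y : Fin n → ℂ) :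
    ∃! g, IsLeastSquares I x y g :=
  ⟨_, (h.isLeastSquares_iff hn y _).mpr rfl, fun g hg => (h.isLeastSquares_iff hn y g).mp hg⟩

theorem mFourierCoeff_leastSquares (h : SamplingStable I x) (hn : 0 < n) (y : Fin n → ℂ) (k : I) :
    mFourierCoeff (leastSquares I x y) k = ∑ i, fourierPinv I x k i * y i := by
  have hu := h.existsUnique_isLeastSquares hn y
  rw [leastSquares, dif_pos hu, (h.isLeastSquares_iff hn y _).mp hu.choose_spec.1,
    mFourierCoeff_trigPolyOfCoeff]
  rfl

/-- Test stability on the `k`-th column `u` of `G⁻¹`. With `b` the squared row norm, `‖F u‖² = b = u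
k`, so `(n/2) b² ≤ (n/2) ‖u‖² ≤ b`. -/
theorem sum_norm_sq_pinv_le (h : SamplingStable I x) (hn : 0 < n) (k : I) :
    ∑ i, ‖fourierPinv I x k i‖ ^ 2 ≤ 2 / n := by
  set F := fourierMatrix I x with hF
  set G := Fᴴ * F with hG
  have hGu := (Matrix.isUnit_iff_isUnit_det _).mp (h.isUnit_gram hn)
  have hGh : (G⁻¹)ᴴ = G⁻¹ := (Matrix.isHermitian_conjTranspose_mul_self F).inv.eq
  have hP : (fourierPinv I x)ᴴ = F * G⁻¹ := by
    rw [fourierPinv, Matrix.conjTranspose_mul, Matrix.conjTranspose_conjTranspose, hGh]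
  set u : I → ℂ := fun l => G⁻¹ l k with hu
  have hFu (i : Fin n) : (F *ᵥ u) i = star (fourierPinv I x k i) := by
    rw [← Matrix.conjTranspose_apply, hP]
    rfl
  set b := ∑ i, ‖fourierPinv I x k i‖ ^ 2 with hb
  have h1 : ∑ i, ‖(F *ᵥ u) i‖ ^ 2 = b := by simp only [hFu, norm_star, hb]
  have h2 : u k = b := by
    have h3 : (fourierPinv I x * (fourierPinv I x)ᴴ) k k = G⁻¹ k k := by
      rw [hP, fourierPinv, Matrix.mul_assoc, ← Matrix.mul_assoc _ F,
        Matrix.mul_nonsing_inv _ hGu, mul_one]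
    rw [hu]
    simp only [← h3, Matrix.mul_apply, Matrix.conjTranspose_apply, hb]
    push_cast
    exact Finset.sum_congr rfl fun i _ => by
      rw [← Complex.mul_conj']; rfl
  have h4 := h u
  rw [← hF, h1] at h4
  have h5 : b ^ 2 ≤ ∑ l, ‖u l‖ ^ 2 := by
    have := Finset.single_le_sum (f := fun l => ‖u l‖ ^ 2) (fun _ _ => by positivity)
      (Finset.mem_univ k)
    simpa [h2] using this
  have hn' : (0 : ℝ) < n := by exact_mod_cast hn
  have hb0 : 0 ≤ b := by positivity
  rw [le_div_iff₀ hn']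
  by_contra! hlt
  have : b * n / 2 * b ≤ 1 * b := by nlinarith
  nlinarith

/-- The diagonal entry of `F⁺ * F = 1` forces the row to have `ℓ¹` norm at least `1`; Cauchy–Schwarz
over `n` entries does the rest. -/
theorem inv_le_sum_norm_sq_pinv (h : SamplingStable I x) (hn : 0 < n) (k : I) :
    1 / n ≤ ∑ i, ‖fourierPinv I x k i‖ ^ 2 := by
  have hn' : (0 : ℝ) < n := by exact_mod_cast hn
  have h1 := congrFun (congrFun (h.pinv_mul hn) k) k
  rw [Matrix.mul_apply, Matrix.one_apply_eq] at h1
  have h2 : (1 : ℝ) ≤ ∑ i, ‖fourierPinv I x k i‖ := by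
    calc (1 : ℝ) = ‖∑ i, fourierPinv I x k i * fourierMatrix I x i k‖ := by rw [h1, norm_one]
      _ ≤ ∑ i, ‖fourierPinv I x k i * fourierMatrix I x i k‖ := norm_sum_le _ _
      _ = _ := by simp [fourierMatrix, norm_mFourier_apply]
  have h3 := sq_sum_le_card_mul_sum_sq (s := Finset.univ) (f := fun i => ‖fourierPinv I x k i‖)
  rw [Finset.card_univ, Fintype.card_fin] at h3
  rw [div_le_iff₀ hn']
  nlinarith

end SamplingStable

end LeastSquares

/-! ### Second moment of a linear combination of the noise. -/

section Noise

variable {Ω' ι : Type*} [MeasurableSpace Ω'] [Fintype ι] {Q : Measure Ω'}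
  {ε : ι → Ω' → ℂ} {σ : ℝ}

theorem integrable_norm_sq_sum_mul (hε_sq : ∀ i, MemLp (ε i) 2 Q) (a : ι → ℂ) :
    Integrable (fun w => ‖∑ i, a i * ε i w‖ ^ 2) Q :=
  (memLp_finsetSum _ fun i _ => (hε_sq i).const_mul (a i)).integrable_norm_pow two_ne_zero

/-- Independent centered variables are uncorrelated, so only the diagonal of the expanded double sum
survives. -/
theorem integral_norm_sq_sum_mul (hε_indep : iIndepFun ε Q) (hε_sq : ∀ i, MemLp (ε i) 2 Q)
    (hε_mean : ∀ i, ∫ w, ε i w ∂Q = 0) (hε_var : ∀ i, ∫ w, ‖ε i w‖ ^ 2 ∂Q = σ ^ 2) (a : ι → ℂ) :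
    ∫ w, ‖∑ i, a i * ε i w‖ ^ 2 ∂Q = σ ^ 2 * ∑ i, ‖a i‖ ^ 2 := by
  classical
  have hcov (i j : ι) : ∫ w, ε i w * star (ε j w) ∂Q = if i = j then (σ : ℂ) ^ 2 else 0 := by
    split_ifs with hij
    · subst hij
      have := hε_var i
      simp_rw [← starRingEnd_apply, Complex.mul_conj']
      exact_mod_cast (integral_ofReal (𝕜 := ℂ)).trans (congrArg _ this)
    · have hind : IndepFun (ε i) (fun w => star (ε j w)) Q :=
        (hε_indep.indepFun hij).comp measurable_id continuous_star.measurable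
      rw [hind.integral_fun_mul_eq_mul_integral (hε_sq i).aestronglyMeasurable
        (hε_sq j).aestronglyMeasurable.star, hε_mean, zero_mul]
  have hint (i j : ι) : Integrable (fun w => ε i w * star (ε j w)) Q :=
    (hε_sq i).integrable_mul (hε_sq j).star
  have hexp (w : Ω') : ((‖∑ i, a i * ε i w‖ ^ 2 : ℝ) : ℂ) =
      ∑ i, ∑ j, a i * star (a j) * (ε i w * star (ε j w)) := by
    push_cast
    rw [← Complex.mul_conj', starRingEnd_apply, star_sum, Finset.sum_mul_sum]
    refine Finset.sum_congr rfl fun i _ => Finset.sum_congr rfl fun j _ => ?_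
    rw [star_mul']
    ring
  apply Complex.ofReal_injective
  rw [← integral_complex_ofReal]
  simp only [hexp]
  rw [integral_finsetSum _ fun i _ => integrable_finsetSum _ fun j _ => (hint i j).const_mul _]
  simp_rw [integral_finsetSum _ fun j _ => (hint _ j).const_mul _, integral_const_mul, hcov]
  push_cast
  rw [Finset.mul_sum]
  refine Finset.sum_congr rfl fun i _ => ?_
  simp only [mul_ite, mul_zero, Finset.sum_ite_eq, Finset.mem_univ, if_true]
  rw [← Complex.mul_conj', mul_comm]
  rfl

end Noise

/-! ### The case without frequencies, and the conclusion. -/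

theorem isLeastSquares_empty_iff {d n : ℕ} {x : Fin n → UnitAddTorus (Fin d)} {y : Fin n → ℂ}
    {g : C(UnitAddTorus (Fin d), ℂ)} : IsLeastSquares ∅ x y g ↔ g = 0 := by
  simp +contextual [IsLeastSquares, trigPoly]

theorem lemma3p2
    {d n : ℕ} (I : Finset (Fin d → ℤ)) (t : ℝ) (ht : 0 < t)
    (hn : 10 * (I.card : ℝ) * (Real.log (I.card : ℝ) + t) ≤ (n : ℝ))
    -- the points: i.i.d. and uniformly distributed on the torus
    {Ω : Type*} [MeasurableSpace Ω] (P : Measure Ω) [IsProbabilityMeasure P]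
    (X : Fin n → Ω → UnitAddTorus (Fin d))
    (hX_indep : iIndepFun X P)
    (hX_unif : ∀ i, HasLaw (X i) (volume : Measure (UnitAddTorus (Fin d))) P)
    -- the noise: i.i.d., complex valued, of mean zero and variance `σ ^ 2`
    {Ω' : Type*} [MeasurableSpace Ω'] (Q : Measure Ω') [IsProbabilityMeasure Q]
    (ε : Fin n → Ω' → ℂ) (σ : ℝ)
    (hε_indep : iIndepFun ε Q)
    (hε_ident : ∀ i j, IdentDistrib (ε i) (ε j) Q Q)
    (hε_sq : ∀ i, MemLp (ε i) 2 Q)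
    (hε_mean : ∀ i, ∫ w, ε i w ∂Q = 0)
    (hε_var : ∀ i, ∫ w, ‖ε i w‖ ^ 2 ∂Q = σ ^ 2) :
    ∃ A : Set Ω, MeasurableSet A ∧ 1 - 2 * Real.exp (-t) ≤ P.real A ∧
      ∀ ω ∈ A,
        (∀ y : Fin n → ℂ, ∃! g, IsLeastSquares I (fun i => X i ω) y g) ∧
        ∀ k ∈ I,
          Integrable (fun w => ‖UnitAddTorus.mFourierCoeff
            (leastSquares I (fun i => X i ω) (fun i => ε i w)) k‖ ^ 2) Q ∧
          2 * σ ^ 2 / (3 * n) ≤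
            ∫ w, ‖UnitAddTorus.mFourierCoeff
              (leastSquares I (fun i => X i ω) (fun i => ε i w)) k‖ ^ 2 ∂Q ∧
          ∫ w, ‖UnitAddTorus.mFourierCoeff
              (leastSquares I (fun i => X i ω) (fun i => ε i w)) k‖ ^ 2 ∂Q ≤
            2 * σ ^ 2 / n := by
  -- Without frequencies `n` may be `0`; otherwise `log |I| ≥ 0` and `t > 0` force `n > 0`.
  rcases I.eq_empty_or_nonempty with rfl | hI
  · refine ⟨Set.univ, .univ, ?_, fun ω _ => ⟨fun y => ⟨0, isLeastSquares_empty_iff.mpr rfl,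
      fun g hg => isLeastSquares_empty_iff.mp hg⟩, by simp⟩⟩
    rw [probReal_univ]
    linarith [Real.exp_pos (-t)]
  have hn0 : 0 < n := by
    have hN : (1 : ℝ) ≤ I.card := by exact_mod_cast hI.card_pos
    have := Real.log_nonneg hN
    have h0 : (0 : ℝ) < n := lt_of_lt_of_le (by positivity) hn
    exact_mod_cast h0
  have hn' : (0 : ℝ) < n := by exact_mod_cast hn0
  -- A measurable hull of the bad event has the same probability, so measurability of stability need
  -- not be shown.
  set S := toMeasurable P {ω | ¬ SamplingStable I fun i => X i ω} with hS
  have hlaw := hX_indep.hasLaw_pi hX_unif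
  have hPS : P.real S ≤ Real.exp (-t) := by
    refine le_trans ?_ (measureReal_not_samplingStable_le (n := n) I hn)
    rw [hS, Measure.real, measure_toMeasurable, Measure.real, ← hlaw.map_eq]
    exact ENNReal.toReal_mono (measure_ne_top _ _) (Measure.le_map_apply hlaw.aemeasurable _)
  refine ⟨Sᶜ, (measurableSet_toMeasurable _ _).compl, ?_, fun ω hω => ?_⟩
  · rw [probReal_compl_eq_one_sub (measurableSet_toMeasurable _ _)]
    linarith [Real.exp_pos (-t)]
  have hst : SamplingStable I fun i => X i ω := by
    by_contra h
    exact hω (subset_toMeasurable _ _ h)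
  refine ⟨hst.existsUnique_isLeastSquares hn0, fun k hk => ?_⟩
  have hcoeff (w : Ω') := hst.mFourierCoeff_leastSquares hn0 (fun i => ε i w) ⟨k, hk⟩
  simp only at hcoeff
  simp_rw [hcoeff, integral_norm_sq_sum_mul hε_indep hε_sq hε_mean hε_var]
  refine ⟨integrable_norm_sq_sum_mul hε_sq _, ?_, ?_⟩
  · calc 2 * σ ^ 2 / (3 * n) = σ ^ 2 * (2 / 3 * (1 / n)) := by field_simp
      _ ≤ σ ^ 2 * (1 / n) := by
        have : (0 : ℝ) < 1 / n := by positivity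
        gcongr
        linarith
      _ ≤ _ := mul_le_mul_of_nonneg_left (hst.inv_le_sum_norm_sq_pinv hn0 _) (sq_nonneg σ)
  · calc _ ≤ σ ^ 2 * (2 / n) :=
          mul_le_mul_of_nonneg_left (hst.sum_norm_sq_pinv_le hn0 _) (sq_nonneg σ)
      _ = _ := by ring
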